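/- Notation. $C^2(\mathbb R^p)$ is the Polish space of twice continuously differentiable functions $\mathbb R^p\to\mathbb R$, with uniform convergence on compact sets of the function and its first and second partial derivatives; $\Rightarrow$ is convergence in law. NaO ("not an object") is an extra isolated point added to $\mathbb R^p$ and to the space of $p\times p$ matrices; it propagates through all operations. For $q\in C^2(\mathbb R^p)$ and $\delta\in\mathbb R^p$ the one-step Newton map is $$G(q,\delta)=\delta+\bigl(-\nabla^2q(\delta)\bigr)^{-1}\nabla q(\delta)$$ if $-\nabla^2q(\delta)$ is positive definite, and $G(q,\delta)=\mathrm{NaO}$ otherwise. The log likelihood of a statistical model with parameter space $\mathbb R^p$ and almost surely positive densities $f_\theta$ with respect to a common measure is $l(\theta)=u(X)+\log f_\theta(X)$, where $u$ does not depend on $\theta$. Lemma. For each $n$ let $q_n$ be a log likelihood, a random element of $C^2(\mathbb R^p)$, with parameter space $\mathbb R^p$ and true parameter value zero, and let $\tilde\delta_n$ be a random element of $\mathbb R^p$ defined on the same probability space. Let $$q(\delta)=\delta'Z-\tfrac12\,\delta'K\delta,\qquad \delta\in\mathbb R^p,$$ be the log likelihood (up to a term not depending on $\delta$) of an LAMN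 (locally asymptotically mixed normal) model, where $Z$ is a random vector and $K$ is a random symmetric matrix: LAMN means that the distribution of $K$ does not depend on the parameter. The law of $q$ is taken under the parameter value zero, and $K$ is assumed to be almost surely positive definite. Suppose that $$q_n\Rightarrow q\quad\text{in } C^2(\mathbb R^p)$$ and that the sequence $\tilde\delta_n$ is tight. Put $\hat\delta_n=G(q_n,\tilde\delta_n)$. Then $$-\nabla^2q_n(\tilde\delta_n)\Rightarrow K,\qquad -\nabla^2q_n(\hat\delta_n)\Rightarrow K,\qquad \hat\delta_n\Rightarrow K^{-1}Z,\qquad \bigl(-\nabla^2q_n(\hat\delta_n)\bigr)^{1/2}\hat\delta_n\Rightarrow \mathrm{Normal}(0,I),$$ where the matrix square root is the symmetric square root when the matrix is positive definite and NaO otherwise. Moreover, these four convergences and $q_n\Rightarrow q$ hold jointly, the limits being $K$, $K$, $K^{-1}Z$, $K^{-1/2}Z$ and $q$, where $K^{-1/2}Z$ has the $\mathrm{Normal}(0,I)$ distribution. (Joint convergence of $(q_n,\tilde\delta_n)$ is neither assumed nor asserted.) -/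

import Mathlib

open MeasureTheory ProbabilityTheory Filter
open scoped Topology Matrix MatrixOrder

set_option synthInstance.maxSize 1024

namespace QuadLik

/-- The parameter space `ℝ^p` (Euclidean norm). -/
abbrev Vec (p : ℕ) : Type := EuclideanSpace ℝ (Fin p)

/-- Real `p × p` matrices. -/
abbrev Mat (p : ℕ) : Type := Matrix (Fin p) (Fin p) ℝ

/-- Matrices carry the product (equivalently, Borel) σ-algebra. -/
instance instMeasurableSpaceMat (p : ℕ) : MeasurableSpace (Mat p) :=
  inferInstanceAs (MeasurableSpace (Fin p → Fin p → ℝ))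

instance instBorelSpaceMat (p : ℕ) : BorelSpace (Mat p) :=
  inferInstanceAs (BorelSpace (Fin p → Fin p → ℝ))

instance instSecondCountableMat (p : ℕ) : SecondCountableTopology (Mat p) :=
  inferInstanceAs (SecondCountableTopology (Fin p → Fin p → ℝ))

/-- Matrix times vector. -/
noncomputable def mv {p : ℕ} (A : Mat p) (x : Vec p) : Vec p := WithLp.toLp 2 (A *ᵥ x.ofLp)

/-! ### Adding the isolated point NaO ("not an object") -/

/-- The space `α` with one new isolated point: the topological disjoint union of `α` and a
point. -/
abbrev WithNaO (α : Type*) : Type _ := α ⊕ Unit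

/-- The extra point. -/
abbrev NaO {α : Type*} : WithNaO α := Sum.inr ()

/-- The σ-algebra of the disjoint union is the Borel σ-algebra. -/
instance instBorelSpaceWithNaO {α : Type*} [TopologicalSpace α] [MeasurableSpace α]
    [BorelSpace α] : BorelSpace (WithNaO α) := by
  refine ⟨le_antisymm ?_ ?_⟩
  · intro s hs
    have h1 : MeasurableSet (Sum.inl ⁻¹' s : Set α) := measurable_inl hs
    have h2 : IsOpen (Sum.inr '' (Sum.inr ⁻¹' s) : Set (WithNaO α)) :=
      Topology.IsOpenEmbedding.inr.isOpenMap _ (isOpen_discrete _)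
    have h3 : MeasurableSet[borel (WithNaO α)]
        (Sum.inl '' (Sum.inl ⁻¹' s : Set α) : Set (WithNaO α)) := by
      let _ : MeasurableSpace (WithNaO α) := borel _
      have : BorelSpace (WithNaO α) := ⟨rfl⟩
      exact (Topology.IsOpenEmbedding.inl.measurableEmbedding).measurableSet_image.2 h1
    have h4 : s = Sum.inl '' (Sum.inl ⁻¹' s) ∪ Sum.inr '' (Sum.inr ⁻¹' s) := by
      ext x
      rcases x with a | u
      · simp
      · cases u
        exact ⟨fun h => Or.inr (Set.mem_image_of_mem Sum.inr h), by
          rintro (⟨_, _, h⟩ | ⟨⟨⟩, h, _⟩)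
          exacts [(nomatch h), h]⟩
    rw [h4]
    exact MeasurableSet.union h3 (MeasurableSpace.measurableSet_generateFrom h2)
  · refine MeasurableSpace.generateFrom_le fun s hs => ?_
    have hs' : IsOpen s := hs
    rw [isOpen_sum_iff] at hs'
    exact measurableSet_sum_iff.2 ⟨hs'.1.measurableSet, hs'.2.measurableSet⟩

/-! ### The space `C²(ℝ^p)` -/

/-- Twice continuously differentiable functions `ℝ^p → ℝ`. -/
structure C2 (p : ℕ) where
  /-- the underlying function -/
  toFun : Vec p → ℝ
  contDiff : ContDiff ℝ 2 toFun

namespace C2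

variable {p : ℕ}

instance : CoeFun (C2 p) (fun _ => Vec p → ℝ) := ⟨C2.toFun⟩

/-- The function itself, as an element of `C(ℝ^p)`. -/
def val (f : C2 p) : C(Vec p, ℝ) := ⟨f, f.contDiff.continuous⟩

lemma contDiff_pd (f : C2 p) (i : Fin p) :
    ContDiff ℝ 1 (fun x => fderiv ℝ f x (EuclideanSpace.single i 1)) :=
  (f.contDiff.fderiv_right (m := 1) (by norm_num)).clm_apply contDiff_const

/-- The first partial derivative `∂ᵢ f`. -/
noncomputable def pd (f : C2 p) (i : Fin p) : C(Vec p, ℝ) :=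
  ⟨fun x => fderiv ℝ f x (EuclideanSpace.single i 1), (contDiff_pd f i).continuous⟩

/-- The second partial derivative `∂ⱼ ∂ᵢ f`. -/
noncomputable def pd2 (f : C2 p) (i j : Fin p) : C(Vec p, ℝ) :=
  ⟨fun x => fderiv ℝ (f.pd i) x (EuclideanSpace.single j 1),
    (((contDiff_pd f i).fderiv_right (m := 0) (by norm_num)).clm_apply
      contDiff_const).continuous⟩

/-- `C²(ℝ^p)` sits in `C(ℝ^p)^(1 + p + p × p)`. -/
noncomputable def embed (f : C2 p) :
    C(Vec p, ℝ) × (Fin p → C(Vec p, ℝ)) × (Fin p → Fin p → C(Vec p, ℝ)) :=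
  (f.val, f.pd, f.pd2)

/-- The topology of uniform convergence on compact sets of the functions and of their first
and second partial derivatives (each `C(ℝ^p)` carries the compact-open topology). -/
noncomputable instance : TopologicalSpace (C2 p) := TopologicalSpace.induced embed inferInstance

instance : SecondCountableTopology (C2 p) :=
  TopologicalSpace.secondCountableTopology_induced _ _ embed

/-- The Borel σ-algebra. -/
noncomputable instance : MeasurableSpace (C2 p) := borel _

instance : BorelSpace (C2 p) := ⟨rfl⟩

/-- The gradient `∇ f(x)`. -/
noncomputable def grad (f : C2 p) (x : Vec p) : Vec p := WithLp.toLp 2 fun i => f.pd i x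

/-- The Hessian matrix `∇² f(x)`. -/
noncomputable def hess (f : C2 p) (x : Vec p) : Mat p := Matrix.of fun i j => f.pd2 i j x

/-- The quadratic `δ ↦ δ' z - ½ δ' K δ`. -/
noncomputable def quad (z : Vec p) (K : Mat p) : C2 p where
  toFun δ := δ.ofLp ⬝ᵥ z.ofLp - 1 / 2 * (δ.ofLp ⬝ᵥ (K *ᵥ δ.ofLp))
  contDiff := by
    simp only [dotProduct, Matrix.mulVec]
    fun_prop

end C2

/-! ### Newton's method -/

section Newton

variable {p : ℕ}

open Classical in
/-- The one-step Newton map `G(q, δ) = δ + (-∇² q(δ))⁻¹ ∇ q(δ)` when `-∇² q(δ)` is positive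
definite, and NaO otherwise. -/
noncomputable def newton (q : C2 p) : WithNaO (Vec p) → WithNaO (Vec p)
  | Sum.inl δ =>
      if (-q.hess δ).PosDef then Sum.inl (δ + mv (-q.hess δ)⁻¹ (q.grad δ)) else NaO
  | Sum.inr _ => NaO

/-- Observed information `-∇² q(δ)`, propagating NaO. -/
noncomputable def obsInfo (q : C2 p) : WithNaO (Vec p) → WithNaO (Mat p)
  | Sum.inl δ => Sum.inl (-q.hess δ)
  | Sum.inr _ => NaO

open Classical in
/-- The product `A^(1/2) x`, where `A^(1/2)` is the symmetric (positive definite) square root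
when `A` is positive definite and NaO otherwise, propagating NaO. -/
noncomputable def sqrtMul : WithNaO (Mat p) → WithNaO (Vec p) → WithNaO (Vec p)
  | Sum.inl A, Sum.inl x => if A.PosDef then Sum.inl (mv (CFC.sqrt A) x) else NaO
  | _, _ => NaO

end Newton

/-! ### Statistical models and log likelihoods -/

/-- A statistical model on the sample space `Ω` with parameter space `ℝ^p`: densities, almost
everywhere positive, of probability distributions with respect to a common measure. -/
structure StatModel (Ω : Type*) [MeasurableSpace Ω] (p : ℕ) where
  /-- the dominating measure -/
  dom : Measure Ω
  /-- the densities -/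
  dens : Vec p → Ω → ℝ
  measurable_dens : ∀ θ, Measurable (dens θ)
  dens_pos : ∀ θ, ∀ᵐ x ∂dom, 0 < dens θ x
  lintegral_dens : ∀ θ, ∫⁻ x, ENNReal.ofReal (dens θ x) ∂dom = 1

namespace StatModel

variable {Ω : Type*} [MeasurableSpace Ω] {p : ℕ}

/-- The distribution of the data for the parameter value `θ`. -/
noncomputable def law (M : StatModel Ω p) (θ : Vec p) : Measure Ω :=
  M.dom.withDensity fun x => ENNReal.ofReal (M.dens θ x)

instance (M : StatModel Ω p) (θ : Vec p) : IsProbabilityMeasure (M.law θ) :=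
  ⟨by rw [law, withDensity_apply _ MeasurableSet.univ, Measure.restrict_univ, M.lintegral_dens]⟩

/-- The random function `l` is the log likelihood of the model: `l(θ) = u(X) + log f_θ(X)`,
where `u` does not depend on the parameter. -/
def IsLogLik (M : StatModel Ω p) (l : Ω → C2 p) : Prop :=
  ∃ u : Ω → ℝ, ∀ θ : Vec p, ∀ᵐ x ∂M.dom, l x θ = u x + Real.log (M.dens θ x)

/-- The model is locally asymptotically mixed normal: its log likelihood is the quadratic
`q(δ) = δ' Z - ½ δ' K δ` (up to a term free of the parameter) with `Z` a random vector and `K` a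
random symmetric matrix whose distribution does not depend on the parameter. -/
structure IsLAMN (M : StatModel Ω p) (Z : Ω → Vec p) (K : Ω → Mat p) : Prop where
  measurable_Z : Measurable Z
  measurable_K : Measurable K
  isSymm_K : ∀ x, (K x).IsSymm
  isLogLik : M.IsLogLik fun x => C2.quad (Z x) (K x)
  law_K : ∀ θ, (M.law θ).map K = (M.law 0).map K

end StatModel

end QuadLik

open QuadLik

/-!
The statistics in the theorem are a function `H (q, δ)` of the log likelihood and of the starting
point (`newtonStats`). When `q` is the quadratic `δ' z - ½ δ' K δ` with `K` positive definite, the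
Hessian is the constant `-K` and one Newton step leads from any point to `K⁻¹ z`; so `H (q, ·)` is
constant (`newtonStats_quad`). Moreover `H` is continuous at every such `(q, δ)`
(`continuousAt_newtonStats`): Hessians of `C²` functions are symmetric, positive definiteness is
open among symmetric matrices, and the symmetric square root is continuous
(`continuousOn_sqrt_mat`).

This is enough for the joint convergence (`tendstoInDistribution_of_isTightMeasureSet`). Let `G` be
open and let `C` be a compact set that contains the starting points up to probability `ε`. By
the tube lemma, if the value of `H (q, ·)` at the limit `q` lies in `G`, then all `q'` near `q`
satisfy `H (q', δ) ∈ G` for every `δ ∈ C`. These `q'` form a neighbourhood to which the portmanteau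
theorem applies, and this bounds `liminf P(H (qₙ, δₙ) ∈ G)` from below, up to `ε`. Neither
Prokhorov's theorem nor a joint limit of the log likelihoods and starting points enters.

The law of `K^(-1/2) Z` comes from the LAMN property. The likelihood ratio of `θ` against `0` is
`exp (θ' Z - ½ θ' K θ)`, and since the law of `K` does not depend on `θ`,
`E[1_B(K) exp (θ' Z)] = E[1_B(K) exp (½ θ' K θ)]` for all Borel sets `B`
(`StatModel.IsLAMN.setLIntegral_exp`). The right side is what `K^(1/2) W` gives in place of `Z`, with
`W` standard normal and independent of `K`. For `B` relatively compact both sides are finite, so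
Laplace transforms identify the laws (`measure_ext_of_lintegral_exp`), whence
`(K, Z)` is distributed as `(K, K^(1/2) W)` and `K^(-1/2) Z` as `W`.
-/

namespace QuadLik

/-! ### Matrices: positive definiteness, inverse and square root -/

section Matrix

variable {p : ℕ}

lemma continuous_mv : Continuous fun a : Mat p × Vec p => mv a.1 a.2 := by
  unfold mv
  fun_prop

lemma mv_mul (A B : Mat p) (x : Vec p) : mv (A * B) x = mv A (mv B x) := by
  simp [mv]

lemma mv_one (x : Vec p) : mv 1 x = x := by
  simp [mv]

lemma mv_sub (A : Mat p) (x y : Vec p) : mv A (x - y) = mv A x - mv A y := by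
  simp [mv, Matrix.mulVec_sub]

/-- Positive definiteness is an open condition among symmetric matrices. -/
lemma eventually_posDef {B : Mat p} (hB : B.PosDef) :
    ∀ᶠ A in 𝓝 B, A.IsHermitian → A.PosDef := by
  have hpos := (Matrix.posDef_iff_dotProduct_mulVec.1 hB).2
  have key : ∀ᶠ A in 𝓝 B, ∀ x ∈ Metric.sphere (0 : Fin p → ℝ) 1, 0 < x ⬝ᵥ A *ᵥ x := by
    refine (isCompact_sphere _ _).eventually_forall_of_forall_eventually fun x hx => ?_
    have hc : Continuous fun z : Mat p × (Fin p → ℝ) => z.2 ⬝ᵥ z.1 *ᵥ z.2 := by fun_prop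
    exact hc.continuousAt.eventually (lt_mem_nhds (hpos (ne_zero_of_mem_unit_sphere ⟨x, hx⟩)))
  filter_upwards [key] with A hA hAH
  refine Matrix.PosDef.of_dotProduct_mulVec_pos hAH fun x hx => ?_
  have h := hA (‖x‖⁻¹ • x) (by simp [norm_smul, hx])
  rw [Matrix.mulVec_smul, dotProduct_smul, smul_dotProduct, smul_eq_mul, smul_eq_mul] at h
  have hn : 0 < ‖x‖⁻¹ := inv_pos.2 (norm_pos_iff.2 hx)
  exact (mul_pos_iff_of_pos_left hn).1 ((mul_pos_iff_of_pos_left hn).1 h)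

lemma measurableSet_posDef : MeasurableSet {A : Mat p | A.PosDef} := by
  have : {A : Mat p | A.PosDef} =
      {A | A.IsHermitian} ∩ interior {A | A.IsHermitian → A.PosDef} := by
    ext A
    exact ⟨fun h => ⟨h.1, mem_interior_iff_mem_nhds.2 (eventually_posDef h)⟩,
      fun h => interior_subset h.2 h.1⟩
  rw [this]
  have hc : IsClosed {A : Mat p | A.IsHermitian} :=
    isClosed_eq (by fun_prop) continuous_id
  exact hc.measurableSet.inter isOpen_interior.measurableSet

lemma isClosed_nonneg_mat : IsClosed {A : Mat p | 0 ≤ A} := by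
  have : {A : Mat p | 0 ≤ A} =
      {A | A.IsHermitian} ∩ ⋂ x : Fin p → ℝ, {A | 0 ≤ x ⬝ᵥ A *ᵥ x} := by
    ext A
    simp [Matrix.nonneg_iff_posSemidef, Matrix.posSemidef_iff_dotProduct_mulVec]
  rw [this]
  refine (isClosed_eq (by fun_prop) continuous_id).inter (isClosed_iInter fun x => ?_)
  exact isClosed_le continuous_const (by fun_prop)

/-- The entries of the square root of a positive semidefinite matrix are controlled by the
diagonal of the matrix. -/
lemma sq_sqrt_apply_le {A : Mat p} (hA : 0 ≤ A) (i j : Fin p) : (CFC.sqrt A i j) ^ 2 ≤ A i i := by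
  have hs : (CFC.sqrt A).IsHermitian := (Matrix.nonneg_iff_posSemidef.1 (CFC.sqrt_nonneg A)).1
  have h : A i i = ∑ k, CFC.sqrt A i k ^ 2 := by
    conv_lhs => rw [← CFC.sqrt_mul_sqrt_self A hA, Matrix.mul_apply]
    refine Finset.sum_congr rfl fun k _ => ?_
    rw [sq]
    congr 1
    simpa using (hs.apply i k)
  rw [h]
  exact Finset.single_le_sum (f := fun k => CFC.sqrt A i k ^ 2) (fun k _ => sq_nonneg _)
    (Finset.mem_univ j)

/-- The symmetric square root is continuous on the positive semidefinite matrices: square roots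
of nearby matrices stay in a compact set, and every limit point of them is the square root of
the limit by uniqueness. -/
lemma continuousOn_sqrt_mat : ContinuousOn (CFC.sqrt : Mat p → Mat p) {A | 0 ≤ A} := by
  intro B hB
  rw [ContinuousWithinAt, tendsto_iff_ultrafilter]
  intro U hU
  have hU0 : ∀ᶠ A in (U : Filter (Mat p)), 0 ≤ A :=
    hU self_mem_nhdsWithin
  have hUB : (U : Filter (Mat p)) ≤ 𝓝 B := hU.trans nhdsWithin_le_nhds
  let C : Set (Mat p) := Set.univ.pi fun i => Set.univ.pi fun _ =>
    Metric.closedBall (0 : ℝ) (Real.sqrt (B i i + 1))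
  have hC : IsCompact C :=
    isCompact_univ_pi fun i => isCompact_univ_pi fun _ => isCompact_closedBall _ _
  have hmem : ∀ᶠ A in (U : Filter (Mat p)), CFC.sqrt A ∈ C := by
    have hd : ∀ᶠ A in (U : Filter (Mat p)), ∀ i, A i i < B i i + 1 := by
      refine eventually_all.2 fun i => ?_
      have hc : Continuous fun A : Mat p => A i i := by fun_prop
      exact hUB (hc.continuousAt.eventually (gt_mem_nhds (lt_add_one _)))
    filter_upwards [hd, hU0] with A hA hA0
    intro i _ j _
    rw [mem_closedBall_zero_iff, Real.norm_eq_abs]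
    exact Real.abs_le_sqrt ((sq_sqrt_apply_le hA0 i j).trans (hA i).le)
  obtain ⟨S, -, hS⟩ := hC.ultrafilter_le_nhds (U.map CFC.sqrt) (le_principal_iff.2 hmem)
  have hS' : Tendsto CFC.sqrt (U : Filter (Mat p)) (𝓝 S) := hS
  have hS0 : 0 ≤ S :=
    isClosed_nonneg_mat.mem_of_tendsto hS' (Eventually.of_forall fun A => CFC.sqrt_nonneg A)
  have hSS : S * S = B := by
    refine tendsto_nhds_unique (hS'.mul hS') (Tendsto.congr' ?_ (tendsto_id'.2 hUB))
    filter_upwards [hU0] with A hA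
    exact (CFC.sqrt_mul_sqrt_self A hA).symm
  rwa [CFC.sqrt_unique hSS hS0]

lemma nonneg_of_posDef {A : Mat p} (hA : A.PosDef) : 0 ≤ A :=
  Matrix.nonneg_iff_posSemidef.2 hA.posSemidef

lemma measurable_sqrt_mat : Measurable (CFC.sqrt : Mat p → Mat p) := by
  classical
  have h : (CFC.sqrt : Mat p → Mat p) = {A : Mat p | 0 ≤ A}.piecewise CFC.sqrt fun _ => 0 := by
    ext1 A
    by_cases hA : 0 ≤ A
    · simp [Set.piecewise, hA]
    · simp [Set.piecewise, hA, CFC.sqrt, cfcₙ_apply_of_not_predicate]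
  rw [h]
  exact continuousOn_sqrt_mat.measurable_piecewise continuousOn_const
    isClosed_nonneg_mat.measurableSet

lemma continuousAt_inv_mat {A : Mat p} (hA : A.PosDef) : ContinuousAt (fun B : Mat p => B⁻¹) A := by
  refine continuousAt_matrix_inv A ?_
  rw [Ring.inverse_eq_inv']
  exact continuousAt_inv₀ hA.det_pos.ne'

lemma measurable_inv_mat : Measurable fun A : Mat p => A⁻¹ := by
  have hd : Continuous fun A : Mat p => A.det := by fun_prop
  have ha : Continuous fun A : Mat p => A.adjugate := by fun_prop
  have h : (fun A : Mat p => A⁻¹) = fun A => (A.det)⁻¹ • A.adjugate := by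
    ext1 A
    rw [Matrix.inv_def, Ring.inverse_eq_inv']
  have hm : Continuous fun z : ℝ × Mat p => z.1 • z.2 := continuous_smul
  rw [h]
  exact hm.measurable.comp (hd.measurable.inv.prodMk ha.measurable)

lemma measurable_mv_inv {α : Type*} [MeasurableSpace α] {A : α → Mat p} {z : α → Vec p}
    (hA : Measurable A) (hz : Measurable z) : Measurable fun x => mv (A x)⁻¹ (z x) := by
  have h : Measurable fun x => ((A x)⁻¹, z x) := (measurable_inv_mat.comp hA).prodMk hz
  exact continuous_mv.measurable.comp h

lemma measurable_mv_inv_sqrt {α : Type*} [MeasurableSpace α] {A : α → Mat p} {z : α → Vec p}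
    (hA : Measurable A) (hz : Measurable z) : Measurable fun x => mv (CFC.sqrt (A x))⁻¹ (z x) :=
  measurable_mv_inv (measurable_sqrt_mat.comp hA) hz

lemma isUnit_sqrt {A : Mat p} (hA : A.PosDef) : IsUnit (CFC.sqrt A) :=
  IsUnit.of_mul_eq_one _ (show CFC.sqrt A * (CFC.sqrt A * A⁻¹) = 1 by
    rw [← mul_assoc, CFC.sqrt_mul_sqrt_self A (nonneg_of_posDef hA),
      Matrix.mul_nonsing_inv _ ((Matrix.isUnit_iff_isUnit_det A).1 hA.isUnit)])

lemma sqrt_mul_inv {A : Mat p} (hA : A.PosDef) : CFC.sqrt A * A⁻¹ = (CFC.sqrt A)⁻¹ := by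
  have hu := (Matrix.isUnit_iff_isUnit_det _).1 (isUnit_sqrt hA)
  conv_lhs => enter [2]; rw [← CFC.sqrt_mul_sqrt_self A (nonneg_of_posDef hA)]
  rw [Matrix.mul_inv_rev, ← mul_assoc, Matrix.mul_nonsing_inv _ hu, one_mul]

end Matrix

/-! ### The space `C²(ℝ^p)` -/

namespace C2

variable {p : ℕ}

lemma continuous_pd : Continuous (pd : C2 p → Fin p → C(Vec p, ℝ)) :=
  continuous_fst.comp (continuous_snd.comp (continuous_induced_dom (f := embed (p := p))))

lemma continuous_pd2 : Continuous (pd2 : C2 p → Fin p → Fin p → C(Vec p, ℝ)) :=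
  continuous_snd.comp (continuous_snd.comp (continuous_induced_dom (f := embed (p := p))))

lemma continuous_grad : Continuous fun a : C2 p × Vec p => a.1.grad a.2 := by
  unfold grad
  refine (PiLp.continuous_toLp 2 _).comp (continuous_pi fun i => ?_)
  exact continuous_eval.comp
    ((((continuous_apply i).comp continuous_pd).comp continuous_fst).prodMk continuous_snd)

lemma continuous_hess : Continuous fun a : C2 p × Vec p => a.1.hess a.2 := by
  unfold hess
  refine continuous_pi fun i => continuous_pi fun j => ?_
  exact continuous_eval.comp (((((continuous_apply j).comp (continuous_apply i)).comp
    continuous_pd2).comp continuous_fst).prodMk continuous_snd)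

/-- The space is second countable and, as a subspace of a product of function spaces, regular;
hence the portmanteau theorem applies in it. -/
instance : TopologicalSpace.PseudoMetrizableSpace (C2 p) := by
  have : RegularSpace (C2 p) := (Topology.IsInducing.mk (f := embed (p := p)) rfl).regularSpace
  infer_instance

lemma isHermitian_hess (f : C2 p) (x : Vec p) : (f.hess x).IsHermitian := by
  have h2 : DifferentiableAt ℝ (fderiv ℝ f) x :=
    (f.contDiff.fderiv_right (m := 1) (by norm_num)).differentiable one_ne_zero x
  have h (i j : Fin p) : f.hess x i j =
      fderiv ℝ (fderiv ℝ f) x (EuclideanSpace.single j 1) (EuclideanSpace.single i 1) := by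
    change fderiv ℝ (fun y => fderiv ℝ f y (EuclideanSpace.single i 1)) x _ = _
    rw [fderiv_clm_apply h2 (differentiableAt_const _)]
    simp
  ext i j
  rw [Matrix.conjTranspose_apply, star_trivial, h, h]
  exact (f.contDiff.contDiffAt.isSymmSndFDerivAt (by simp)).eq _ _

lemma pd_quad (z : Vec p) {K : Mat p} (hK : K.IsSymm) (i : Fin p) (x : Vec p) :
    (quad z K).pd i x = z i - (K *ᵥ x.ofLp) i := by
  let e : Vec p := EuclideanSpace.single i 1
  change fderiv ℝ (quad z K) x e = _
  have hd : DifferentiableAt ℝ (quad z K) x := (quad z K).contDiff.differentiable two_ne_zero x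
  rw [← hd.lineDeriv_eq_fderiv, lineDeriv]
  have hsymm : x.ofLp ⬝ᵥ K *ᵥ e.ofLp = e.ofLp ⬝ᵥ K *ᵥ x.ofLp := by
    rw [Matrix.dotProduct_mulVec, ← Matrix.mulVec_transpose, hK.eq, dotProduct_comm]
  have hq : (fun t : ℝ => quad z K (x + t • e)) = fun t => quad z K x +
      t * (e.ofLp ⬝ᵥ z.ofLp - e.ofLp ⬝ᵥ K *ᵥ x.ofLp) - t ^ 2 * (1 / 2 * (e.ofLp ⬝ᵥ K *ᵥ e.ofLp)) := by
    funext t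
    simp only [quad, WithLp.ofLp_add, WithLp.ofLp_smul, Matrix.mulVec_add, Matrix.mulVec_smul,
      dotProduct_add, add_dotProduct, dotProduct_smul, smul_dotProduct, smul_eq_mul, hsymm]
    ring
  have hder := (((hasDerivAt_id (0 : ℝ)).mul_const
    (e.ofLp ⬝ᵥ z.ofLp - e.ofLp ⬝ᵥ K *ᵥ x.ofLp)).const_add (quad z K x)).sub
    (((hasDerivAt_id (0 : ℝ)).pow 2).mul_const (1 / 2 * (e.ofLp ⬝ᵥ K *ᵥ e.ofLp)))
  rw [hq]
  refine hder.deriv.trans ?_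
  simp [e]

lemma grad_quad (z : Vec p) {K : Mat p} (hK : K.IsSymm) (x : Vec p) :
    (quad z K).grad x = z - mv K x := by
  ext i
  exact pd_quad z hK i x

lemma hess_quad (z : Vec p) {K : Mat p} (hK : K.IsSymm) (x : Vec p) :
    (quad z K).hess x = -K := by
  ext i j
  have hp : ((quad z K).pd i : Vec p → ℝ) = fun y => z i - K i ⬝ᵥ y.ofLp :=
    funext fun y => pd_quad z hK i y
  change fderiv ℝ ((quad z K).pd i) x (EuclideanSpace.single j 1) = _
  have hd : DifferentiableAt ℝ (fun y : Vec p => z i - K i ⬝ᵥ y.ofLp) x := by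
    simp only [dotProduct]
    fun_prop
  rw [hp, ← hd.lineDeriv_eq_fderiv, lineDeriv]
  have hq : (fun t : ℝ => z i - K i ⬝ᵥ (x + t • EuclideanSpace.single j (1 : ℝ)).ofLp) =
      fun t => (z i - K i ⬝ᵥ x.ofLp) - t * K i j := by
    funext t
    simp only [WithLp.ofLp_add, WithLp.ofLp_smul, dotProduct_add, dotProduct_smul, smul_eq_mul]
    simp
    ring
  rw [hq]
  refine (((hasDerivAt_id (0 : ℝ)).mul_const (K i j)).const_sub _).deriv.trans ?_
  simp

end C2

/-! ### Continuity and measurability of the Newton step -/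

section Newton

variable {p : ℕ}

/-- The value of a Newton step at a point where the Hessian is negative definite. -/
noncomputable def newtonStep (a : C2 p × Vec p) : Vec p :=
  a.2 + mv (-a.1.hess a.2)⁻¹ (a.1.grad a.2)

/-- The observed information at the end point of a Newton step. -/
noncomputable def newtonInfo (a : C2 p × Vec p) : Mat p := -a.1.hess (newtonStep a)

lemma newton_of_posDef {a : C2 p × Vec p} (h : (-a.1.hess a.2).PosDef) :
    newton a.1 (Sum.inl a.2) = Sum.inl (newtonStep a) := if_pos h

lemma newton_of_not_posDef {a : C2 p × Vec p} (h : ¬(-a.1.hess a.2).PosDef) :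
    newton a.1 (Sum.inl a.2) = NaO := if_neg h

lemma newtonStep_quad (z : Vec p) {K : Mat p} (hK : K.PosDef) (x : Vec p) :
    newtonStep (C2.quad z K, x) = mv K⁻¹ z := by
  have hs : K.IsSymm := by simpa using hK.1
  have hu := (Matrix.isUnit_iff_isUnit_det K).1 hK.isUnit
  rw [newtonStep, C2.hess_quad z hs, C2.grad_quad z hs, neg_neg, mv_sub, ← mv_mul,
    Matrix.nonsing_inv_mul _ hu, mv_one, add_sub_cancel]

lemma newtonInfo_quad (z : Vec p) {K : Mat p} (hK : K.PosDef) (x : Vec p) :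
    newtonInfo (C2.quad z K, x) = K := by
  have hs : K.IsSymm := by simpa using hK.1
  rw [newtonInfo, C2.hess_quad z hs, neg_neg]

lemma measurable_newtonStep : Measurable (newtonStep : C2 p × Vec p → Vec p) :=
  measurable_snd.add (continuous_mv.measurable.comp
    ((measurable_inv_mat.comp C2.continuous_hess.neg.measurable).prodMk
      C2.continuous_grad.measurable))

lemma measurable_newtonInfo : Measurable (newtonInfo : C2 p × Vec p → Mat p) :=
  C2.continuous_hess.neg.measurable.comp (measurable_fst.prodMk measurable_newtonStep)

lemma continuousAt_newtonStep {a : C2 p × Vec p} (h : (-a.1.hess a.2).PosDef) :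
    ContinuousAt newtonStep a := by
  have hi : ContinuousAt (fun b : C2 p × Vec p => (-b.1.hess b.2)⁻¹) a :=
    ContinuousAt.comp (g := fun B : Mat p => B⁻¹) (continuousAt_inv_mat h)
      C2.continuous_hess.neg.continuousAt
  exact continuousAt_snd.add (continuous_mv.continuousAt.comp
    (hi.prodMk C2.continuous_grad.continuousAt))

lemma continuousAt_newtonInfo {a : C2 p × Vec p} (h : (-a.1.hess a.2).PosDef) :
    ContinuousAt newtonInfo a :=
  C2.continuous_hess.neg.continuousAt.comp
    (f := fun b : C2 p × Vec p => (b.1, newtonStep b))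
    (continuousAt_fst.prodMk (continuousAt_newtonStep h))

/-- The statistics of the theorem as a function of the log likelihood and the starting point. -/
noncomputable def newtonStats (a : C2 p × Vec p) :
    C2 p × Mat p × WithNaO (Mat p) × WithNaO (Vec p) × WithNaO (Vec p) :=
  (a.1, -a.1.hess a.2, obsInfo a.1 (newton a.1 (Sum.inl a.2)), newton a.1 (Sum.inl a.2),
    sqrtMul (obsInfo a.1 (newton a.1 (Sum.inl a.2))) (newton a.1 (Sum.inl a.2)))

lemma newtonStats_of_posDef {a : C2 p × Vec p} (h : (-a.1.hess a.2).PosDef)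
    (h' : (newtonInfo a).PosDef) :
    newtonStats a = (a.1, -a.1.hess a.2, Sum.inl (newtonInfo a), Sum.inl (newtonStep a),
      Sum.inl (mv (CFC.sqrt (newtonInfo a)) (newtonStep a))) := by
  have hs : sqrtMul (Sum.inl (newtonInfo a)) (Sum.inl (newtonStep a)) =
      Sum.inl (mv (CFC.sqrt (newtonInfo a)) (newtonStep a)) := if_pos h'
  rw [newtonStats, newton_of_posDef h, ← hs]
  rfl

open Classical in
lemma measurable_newtonStats : Measurable (newtonStats (p := p)) := by
  have hP : MeasurableSet {a : C2 p × Vec p | (-a.1.hess a.2).PosDef} :=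
    C2.continuous_hess.neg.measurable measurableSet_posDef
  have hP' : MeasurableSet {a : C2 p × Vec p | (newtonInfo a).PosDef} :=
    measurable_newtonInfo measurableSet_posDef
  have h3 : (fun a : C2 p × Vec p => obsInfo a.1 (newton a.1 (Sum.inl a.2))) =
      fun a => if (-a.1.hess a.2).PosDef then Sum.inl (newtonInfo a) else NaO := by
    funext a
    by_cases h : (-a.1.hess a.2).PosDef
    · rw [newton_of_posDef h, if_pos h]
      rfl
    · rw [newton_of_not_posDef h, if_neg h]
      rfl
  have h5 : (fun a : C2 p × Vec p =>
      sqrtMul (obsInfo a.1 (newton a.1 (Sum.inl a.2))) (newton a.1 (Sum.inl a.2))) =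
      fun a => if (-a.1.hess a.2).PosDef then (if (newtonInfo a).PosDef then
        Sum.inl (mv (CFC.sqrt (newtonInfo a)) (newtonStep a)) else NaO) else NaO := by
    funext a
    by_cases h : (-a.1.hess a.2).PosDef
    · rw [newton_of_posDef h, if_pos h]
      rfl
    · rw [newton_of_not_posDef h, if_neg h]
      rfl
  refine measurable_fst.prodMk (C2.continuous_hess.neg.measurable.prodMk
    (Measurable.prodMk ?_ (Measurable.prodMk ?_ ?_)))
  · rw [h3]
    exact Measurable.ite hP (measurable_inl.comp measurable_newtonInfo) measurable_const
  · exact Measurable.ite hP (measurable_inl.comp measurable_newtonStep) measurable_const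
  · rw [h5]
    exact Measurable.ite hP (Measurable.ite hP' (measurable_inl.comp (continuous_mv.measurable.comp
      ((measurable_sqrt_mat.comp measurable_newtonInfo).prodMk measurable_newtonStep)))
      measurable_const) measurable_const

lemma continuousAt_newtonStats {a : C2 p × Vec p} (h : (-a.1.hess a.2).PosDef)
    (h' : (newtonInfo a).PosDef) : ContinuousAt newtonStats a := by
  have hI := continuousAt_newtonInfo h
  have hP : ∀ᶠ b in 𝓝 a, (-b.1.hess b.2).PosDef := by
    filter_upwards [C2.continuous_hess.neg.continuousAt.eventually (eventually_posDef h)] with b hb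
    exact hb (C2.isHermitian_hess _ _).neg
  have hP' : ∀ᶠ b in 𝓝 a, (newtonInfo b).PosDef := by
    filter_upwards [hI.eventually (eventually_posDef h')] with b hb
    exact hb (C2.isHermitian_hess _ _).neg
  have hS : ContinuousAt (fun b => CFC.sqrt (newtonInfo b)) a := by
    have h1 : Tendsto newtonInfo (𝓝 a) (𝓝[{A | 0 ≤ A}] (newtonInfo a)) :=
      tendsto_nhdsWithin_iff.2 ⟨hI, hP'.mono fun b hb => nonneg_of_posDef hb⟩
    exact (continuousOn_sqrt_mat _ (nonneg_of_posDef h')).tendsto.comp h1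
  refine ContinuousAt.congr (f := fun b : C2 p × Vec p => ((b.1, -b.1.hess b.2,
    Sum.inl (newtonInfo b), Sum.inl (newtonStep b),
    Sum.inl (mv (CFC.sqrt (newtonInfo b)) (newtonStep b))) :
      C2 p × Mat p × WithNaO (Mat p) × WithNaO (Vec p) × WithNaO (Vec p))) ?_ ?_
  · refine continuousAt_fst.prodMk (C2.continuous_hess.neg.continuousAt.prodMk
      (ContinuousAt.prodMk (continuous_inl.continuousAt.comp hI)
        (ContinuousAt.prodMk (continuous_inl.continuousAt.comp (continuousAt_newtonStep h)) ?_)))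
    exact continuous_inl.continuousAt.comp (continuous_mv.continuousAt.comp
      (hS.prodMk (continuousAt_newtonStep h)))
  · filter_upwards [hP, hP'] with b hb hb'
    exact (newtonStats_of_posDef hb hb').symm

/-- For a quadratic log likelihood the statistics do not depend on the starting point. -/
lemma newtonStats_quad (z : Vec p) {K : Mat p} (hK : K.PosDef) (x : Vec p) :
    newtonStats (C2.quad z K, x) = (C2.quad z K, K, Sum.inl K, Sum.inl (mv K⁻¹ z),
      Sum.inl (mv (CFC.sqrt K)⁻¹ z)) := by
  have hs : K.IsSymm := by simpa using hK.1
  have hh : -(C2.quad z K).hess x = K := by rw [C2.hess_quad z hs, neg_neg]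
  rw [newtonStats_of_posDef (by rwa [hh]) (by rwa [newtonInfo_quad z hK]), hh,
    newtonInfo_quad z hK, newtonStep_quad z hK, ← mv_mul, sqrt_mul_inv hK]

end Newton

/-! ### Finite measures are determined by their Laplace transforms -/

/-- Two finite measures with the same everywhere finite Laplace transform are equal: their
one-dimensional projections agree by analytic continuation of the moment generating function, and
these determine the characteristic functions. -/
lemma measure_ext_of_lintegral_exp {E : Type*} [NormedAddCommGroup E] [NormedSpace ℝ E]
    [MeasurableSpace E] [BorelSpace E] [SecondCountableTopology E] [CompleteSpace E]
    {μ ν : Measure E} [IsFiniteMeasure μ] [IsFiniteMeasure ν]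
    (h : ∀ L : StrongDual ℝ E, ∫⁻ z, ENNReal.ofReal (Real.exp (L z)) ∂μ =
      ∫⁻ z, ENNReal.ofReal (Real.exp (L z)) ∂ν)
    (hfin : ∀ L : StrongDual ℝ E, ∫⁻ z, ENNReal.ofReal (Real.exp (L z)) ∂μ ≠ ⊤) : μ = ν := by
  have hint (L : StrongDual ℝ E) : Integrable (fun z => Real.exp (L z)) μ := by
    refine ⟨by fun_prop, ?_⟩
    rw [hasFiniteIntegral_iff_ofReal (Eventually.of_forall fun z => (Real.exp_pos _).le)]
    exact (hfin L).lt_top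
  refine Measure.ext_of_charFunDual (funext fun L => ?_)
  have hmgf : mgf L μ = mgf L ν := by
    funext t
    rw [mgf, mgf, integral_eq_lintegral_of_nonneg_ae (Eventually.of_forall fun z =>
      (Real.exp_pos _).le) (by fun_prop), integral_eq_lintegral_of_nonneg_ae
      (Eventually.of_forall fun z => (Real.exp_pos _).le) (by fun_prop)]
    exact congrArg ENNReal.toReal (h (t • L))
  have hset : integrableExpSet L μ = Set.univ :=
    Set.eq_univ_of_forall fun t => hint (t • L)
  have hzero : μ = 0 ↔ ν = 0 := by
    have h0 := h 0
    simp only [_root_.zero_apply, Real.exp_zero, ENNReal.ofReal_one,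
      lintegral_one] at h0
    rw [← Measure.measure_univ_eq_zero, ← Measure.measure_univ_eq_zero, h0]
  have hc : complexMGF L μ = complexMGF L ν := by
    funext z
    exact eqOn_complexMGF_of_mgf' hmgf hzero (by simp [hset])
  have hmap : μ.map L = ν.map L :=
    Measure.ext_of_complexMGF_eq (by fun_prop) (by fun_prop) hc
  rw [charFunDual_eq_charFun_map_one, charFunDual_eq_charFun_map_one, hmap]

lemma lintegral_exp_stdGaussian {E : Type*} [NormedAddCommGroup E] [InnerProductSpace ℝ E]
    [FiniteDimensional ℝ E] [MeasurableSpace E] [BorelSpace E] (v : E) :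
    ∫⁻ w, ENNReal.ofReal (Real.exp (inner ℝ v w)) ∂(stdGaussian E) =
      ENNReal.ofReal (Real.exp (‖v‖ ^ 2 / 2)) := by
  have hmap : (stdGaussian E).map (innerSL ℝ v) = gaussianReal 0 (‖v‖ ^ 2).toNNReal := by
    rw [IsGaussian.map_eq_gaussianReal, integral_strongDual_stdGaussian, variance_dual_stdGaussian,
      innerSL_apply_norm]
  have hexp : ∫⁻ r, ENNReal.ofReal (Real.exp r) ∂(gaussianReal 0 (‖v‖ ^ 2).toNNReal) =
      ENNReal.ofReal (Real.exp (‖v‖ ^ 2 / 2)) := by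
    have hi := integrable_exp_mul_gaussianReal (μ := 0) (v := (‖v‖ ^ 2).toNNReal) 1
    have hm := congrFun (mgf_id_gaussianReal (μ := 0) (v := (‖v‖ ^ 2).toNNReal)) 1
    simp only [one_mul] at hi
    rw [← ofReal_integral_eq_lintegral_ofReal hi
      (Eventually.of_forall fun r => (Real.exp_pos r).le)]
    exact congrArg ENNReal.ofReal (by simpa [mgf] using hm)
  rw [← hexp, ← hmap, lintegral_map (by fun_prop) (by fun_prop)]
  rfl

/-! ### The limit model: `Z` is conditionally normal given `K` -/

section LAMN

variable {p : ℕ} {Ω : Type*} [MeasurableSpace Ω]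

/-- In an LAMN model the likelihood ratio of `θ` against `0` is the exponential of the quadratic
log likelihood. -/
lemma StatModel.IsLAMN.law_eq_withDensity {N : StatModel Ω p} {Z : Ω → Vec p} {K : Ω → Mat p}
    (hN : N.IsLAMN Z K) (θ : Vec p) :
    N.law θ = (N.law 0).withDensity
      fun x => ENNReal.ofReal (Real.exp (C2.quad (Z x) (K x) θ)) := by
  have hmeas : Measurable fun x => ENNReal.ofReal (Real.exp (C2.quad (Z x) (K x) θ)) := by
    have hc : Continuous fun a : Vec p × Mat p => C2.quad a.1 a.2 θ := by
      simp only [C2.quad]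
      fun_prop
    exact (hc.measurable.comp (hN.measurable_Z.prodMk hN.measurable_K)).exp.ennreal_ofReal
  obtain ⟨u, hu⟩ := hN.isLogLik
  rw [StatModel.law, StatModel.law,
    ← withDensity_mul _ (N.measurable_dens 0).ennreal_ofReal hmeas]
  refine withDensity_congr_ae ?_
  filter_upwards [hu θ, hu 0, N.dens_pos θ, N.dens_pos 0] with x hθ h0 hpθ hp0
  have hq0 : C2.quad (Z x) (K x) 0 = 0 := by simp [C2.quad]
  have he : C2.quad (Z x) (K x) θ = Real.log (N.dens θ x) - Real.log (N.dens 0 x) := by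
    linarith
  rw [Pi.mul_apply, ← ENNReal.ofReal_mul hp0.le, he, Real.exp_sub, Real.exp_log hpθ,
    Real.exp_log hp0, mul_div_cancel₀ _ hp0.ne']

/-- The Laplace transform of `Z` on an event described by `K`. -/
lemma StatModel.IsLAMN.setLIntegral_exp {N : StatModel Ω p} {Z : Ω → Vec p} {K : Ω → Mat p}
    (hN : N.IsLAMN Z K) (θ : Vec p) {B : Set (Mat p)} (hB : MeasurableSet B) :
    ∫⁻ x in K ⁻¹' B, ENNReal.ofReal (Real.exp (inner ℝ θ (Z x))) ∂(N.law 0) =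
      ∫⁻ x in K ⁻¹' B, ENNReal.ofReal (Real.exp (inner ℝ θ (mv (K x) θ) / 2)) ∂(N.law 0) := by
  have hin (v : Vec p) : inner ℝ θ v = θ.ofLp ⬝ᵥ v.ofLp := by
    rw [EuclideanSpace.inner_eq_star_dotProduct, star_trivial, dotProduct_comm]
  have hc : Continuous fun a : Vec p × Mat p => C2.quad a.1 a.2 θ := by
    simp only [C2.quad]
    fun_prop
  have hmeas : Measurable fun x => ENNReal.ofReal (Real.exp (C2.quad (Z x) (K x) θ)) :=
    (hc.measurable.comp (hN.measurable_Z.prodMk hN.measurable_K)).exp.ennreal_ofReal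
  have hg : Measurable fun A : Mat p => ENNReal.ofReal (Real.exp (inner ℝ θ (mv A θ) / 2)) := by
    have : Continuous fun A : Mat p => inner ℝ θ (mv A θ) / 2 := by
      unfold mv
      fun_prop
    exact this.measurable.exp.ennreal_ofReal
  have hK := hN.measurable_K
  calc
    _ = ∫⁻ x in K ⁻¹' B, (ENNReal.ofReal (Real.exp (C2.quad (Z x) (K x) θ))) *
          ENNReal.ofReal (Real.exp (inner ℝ θ (mv (K x) θ) / 2)) ∂(N.law 0) := by
      refine lintegral_congr fun x => ?_
      rw [← ENNReal.ofReal_mul (Real.exp_pos _).le, ← Real.exp_add, hin, hin]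
      congr 2
      simp only [C2.quad, mv]
      ring
    _ = ∫⁻ x in K ⁻¹' B, ENNReal.ofReal (Real.exp (inner ℝ θ (mv (K x) θ) / 2)) ∂(N.law θ) := by
      rw [hN.law_eq_withDensity θ, restrict_withDensity (hK hB),
        lintegral_withDensity_eq_lintegral_mul _ hmeas
          (g := fun x => ENNReal.ofReal (Real.exp (inner ℝ θ (mv (K x) θ) / 2))) (hg.comp hK)]
      rfl
    _ = ∫⁻ A in B, ENNReal.ofReal (Real.exp (inner ℝ θ (mv A θ) / 2)) ∂((N.law θ).map K) := by
      rw [setLIntegral_map hB hg hK]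
    _ = _ := by
      rw [hN.law_K θ, setLIntegral_map hB hg hK]

lemma transpose_sqrt (A : Mat p) : (CFC.sqrt A)ᵀ = CFC.sqrt A := by
  have h := (Matrix.nonneg_iff_posSemidef.1 (CFC.sqrt_nonneg A)).1
  rwa [Matrix.IsHermitian, Matrix.conjTranspose_eq_transpose_of_trivial] at h

lemma norm_sq_mv_sqrt {A : Mat p} (hA : 0 ≤ A) (θ : Vec p) :
    ‖mv (CFC.sqrt A) θ‖ ^ 2 = inner ℝ θ (mv A θ) := by
  rw [← real_inner_self_eq_norm_sq, EuclideanSpace.inner_eq_star_dotProduct,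
    EuclideanSpace.inner_eq_star_dotProduct, star_trivial, star_trivial]
  simp only [mv]
  rw [Matrix.dotProduct_mulVec, ← Matrix.mulVec_transpose, transpose_sqrt, Matrix.mulVec_mulVec,
    CFC.sqrt_mul_sqrt_self A hA]

lemma inner_mv_sqrt {A : Mat p} (θ w : Vec p) :
    inner ℝ θ (mv (CFC.sqrt A) w) = inner ℝ (mv (CFC.sqrt A) θ) w := by
  rw [EuclideanSpace.inner_eq_star_dotProduct, EuclideanSpace.inner_eq_star_dotProduct,
    star_trivial, star_trivial]
  simp only [mv]
  rw [dotProduct_comm, Matrix.dotProduct_mulVec, ← Matrix.mulVec_transpose, transpose_sqrt,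
    dotProduct_comm]

lemma measurable_mv_sqrt : Measurable fun a : Mat p × Vec p => mv (CFC.sqrt a.1) a.2 :=
  continuous_mv.measurable.comp ((measurable_sqrt_mat.comp measurable_fst).prodMk measurable_snd)

/-- On an event that confines `K` to a compact set, `Z` has the law of `K^(1/2) W`, where `W` is
standard normal and independent of `K`: the two Laplace transforms agree and are finite. -/
lemma StatModel.IsLAMN.map_restrict_eq {N : StatModel Ω p} {Z : Ω → Vec p} {K : Ω → Mat p}
    (hN : N.IsLAMN Z K) (hK : ∀ᵐ x ∂(N.law 0), (K x).PosDef) {B C : Set (Mat p)}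
    (hB : MeasurableSet B) (hC : IsCompact C) (hBC : B ⊆ C) :
    ((N.law 0).restrict (K ⁻¹' B)).map Z =
      (((N.law 0).restrict (K ⁻¹' B)).prod (stdGaussian (Vec p))).map
        fun a => mv (CFC.sqrt (K a.1)) a.2 := by
  have hKm := hN.measurable_K
  have hS : Measurable fun a : Ω × Vec p => mv (CFC.sqrt (K a.1)) a.2 :=
    measurable_mv_sqrt.comp ((hKm.comp measurable_fst).prodMk measurable_snd)
  have hleft (θ : Vec p) : ∫⁻ z, ENNReal.ofReal (Real.exp (innerSL ℝ θ z))
      ∂(((N.law 0).restrict (K ⁻¹' B)).map Z) =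
      ∫⁻ x in K ⁻¹' B, ENNReal.ofReal (Real.exp (inner ℝ θ (mv (K x) θ) / 2)) ∂(N.law 0) := by
    rw [lintegral_map (by fun_prop) hN.measurable_Z, ← hN.setLIntegral_exp θ hB]
    rfl
  have hright (θ : Vec p) : ∫⁻ z, ENNReal.ofReal (Real.exp (innerSL ℝ θ z))
      ∂((((N.law 0).restrict (K ⁻¹' B)).prod (stdGaussian (Vec p))).map
        fun a => mv (CFC.sqrt (K a.1)) a.2) =
      ∫⁻ x in K ⁻¹' B, ENNReal.ofReal (Real.exp (inner ℝ θ (mv (K x) θ) / 2)) ∂(N.law 0) := by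
    have hf : Measurable fun z : Vec p => ENNReal.ofReal (Real.exp (innerSL ℝ θ z)) := by fun_prop
    rw [lintegral_map hf hS, lintegral_prod (fun a : Ω × Vec p =>
      ENNReal.ofReal (Real.exp (innerSL ℝ θ (mv (CFC.sqrt (K a.1)) a.2)))) (hf.comp hS).aemeasurable]
    refine lintegral_congr_ae ?_
    filter_upwards [ae_restrict_of_ae hK] with x hx
    rw [← norm_sq_mv_sqrt (nonneg_of_posDef hx), ← lintegral_exp_stdGaussian]
    exact lintegral_congr fun w => by rw [innerSL_apply_apply, inner_mv_sqrt]
  refine measure_ext_of_lintegral_exp (fun L => ?_) fun L => ?_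
  · obtain ⟨θ, rfl⟩ := (InnerProductSpace.toDual ℝ (Vec p)).surjective L
    exact (hleft θ).trans (hright θ).symm
  · obtain ⟨θ, rfl⟩ := (InnerProductSpace.toDual ℝ (Vec p)).surjective L
    refine ne_of_eq_of_ne (hleft θ) ?_
    have hc : Continuous fun A : Mat p => Real.exp (inner ℝ θ (mv A θ) / 2) := by
      unfold mv
      fun_prop
    obtain ⟨R, hR⟩ := (hC.image hc).bddAbove
    refine ne_top_of_le_ne_top (b := ENNReal.ofReal R * (N.law 0) (K ⁻¹' B))
      (ENNReal.mul_ne_top ENNReal.ofReal_ne_top (measure_ne_top _ _)) ?_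
    rw [← setLIntegral_const]
    exact setLIntegral_mono measurable_const fun x hx =>
      ENNReal.ofReal_le_ofReal (hR ⟨K x, hBC hx, rfl⟩)

/-- `(K, Z)` has the law of `(K, K^(1/2) W)`, where `W` is standard normal and independent
of `K`. -/
lemma StatModel.IsLAMN.map_prodMk_eq {N : StatModel Ω p} {Z : Ω → Vec p} {K : Ω → Mat p}
    (hN : N.IsLAMN Z K) (hK : ∀ᵐ x ∂(N.law 0), (K x).PosDef) :
    (N.law 0).map (fun x => (K x, Z x)) = ((N.law 0).prod (stdGaussian (Vec p))).map
      fun a => (K a.1, mv (CFC.sqrt (K a.1)) a.2) := by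
  have hKm := hN.measurable_K
  have hZm := hN.measurable_Z
  have hS : Measurable fun a : Ω × Vec p => mv (CFC.sqrt (K a.1)) a.2 :=
    measurable_mv_sqrt.comp ((hKm.comp measurable_fst).prodMk measurable_snd)
  have hKS : Measurable fun a : Ω × Vec p => (K a.1, mv (CFC.sqrt (K a.1)) a.2) :=
    (hKm.comp measurable_fst).prodMk hS
  have : SigmaCompactSpace (Mat p) := inferInstanceAs (SigmaCompactSpace (Fin p → Fin p → ℝ))
  refine Measure.ext_prod fun {s t} hs ht => ?_
  have hU : s ×ˢ t = ⋃ n, (s ∩ compactCovering (Mat p) n) ×ˢ t := by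
    rw [← Set.iUnion_prod_const, ← Set.inter_iUnion, iUnion_compactCovering, Set.inter_univ]
  have hmono : Monotone fun n => (s ∩ compactCovering (Mat p) n) ×ˢ t := fun m n hmn =>
    Set.prod_mono (Set.inter_subset_inter_right _ (compactCovering_subset _ hmn)) subset_rfl
  rw [hU, hmono.measure_iUnion, hmono.measure_iUnion]
  refine iSup_congr fun n => ?_
  have hCn := isCompact_compactCovering (Mat p) n
  have hB : MeasurableSet (s ∩ compactCovering (Mat p) n) := hs.inter hCn.measurableSet
  have h := congrArg (fun m => m t) (hN.map_restrict_eq hK hB hCn Set.inter_subset_right)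
  simp only [Measure.map_apply hZm ht, Measure.map_apply hS ht,
    Measure.restrict_apply (hZm ht)] at h
  rw [Measure.map_apply (hKm.prodMk hZm) (hB.prod ht), Measure.map_apply hKS (hB.prod ht)]
  have hprod : ((N.law 0).restrict (K ⁻¹' (s ∩ compactCovering (Mat p) n))).prod
      (stdGaussian (Vec p)) = ((N.law 0).prod (stdGaussian (Vec p))).restrict
        ((K ⁻¹' (s ∩ compactCovering (Mat p) n)) ×ˢ Set.univ) := by
    rw [← Measure.prod_restrict, Measure.restrict_univ]
  rw [hprod, Measure.restrict_apply (hS ht)] at h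
  convert h using 2
  · ext x
    simp only [Set.mem_preimage, Set.mem_prod, Set.mem_inter_iff]
    tauto
  · ext x
    simp only [Set.mem_preimage, Set.mem_prod, Set.mem_inter_iff, Set.mem_univ]
    tauto

/-- `K^(-1/2) Z` is standard normal. -/
lemma StatModel.IsLAMN.map_inv_sqrt_eq {N : StatModel Ω p} {Z : Ω → Vec p} {K : Ω → Mat p}
    (hN : N.IsLAMN Z K) (hK : ∀ᵐ x ∂(N.law 0), (K x).PosDef) :
    (N.law 0).map (fun x => mv (CFC.sqrt (K x))⁻¹ (Z x)) =
      multivariateGaussian (0 : Vec p) (1 : Mat p) := by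
  have hKm := hN.measurable_K
  have hS : Measurable fun a : Ω × Vec p => (K a.1, mv (CFC.sqrt (K a.1)) a.2) :=
    (hKm.comp measurable_fst).prodMk
      (measurable_mv_sqrt.comp ((hKm.comp measurable_fst).prodMk measurable_snd))
  have hg : Measurable fun a : Mat p × Vec p => mv (CFC.sqrt a.1)⁻¹ a.2 :=
    measurable_mv_inv_sqrt measurable_fst measurable_snd
  have h1 := congrArg (Measure.map fun a : Mat p × Vec p => mv (CFC.sqrt a.1)⁻¹ a.2)
    (hN.map_prodMk_eq hK)
  rw [Measure.map_map hg (hKm.prodMk hN.measurable_Z),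
    Measure.map_map hg hS] at h1
  rw [multivariateGaussian_zero_one]
  refine h1.trans ((Measure.map_congr ?_).trans (Measure.snd_prod (μ := N.law 0)))
  filter_upwards [Measure.quasiMeasurePreserving_fst.ae hK] with a ha
  have hu := (Matrix.isUnit_iff_isUnit_det _).1 (isUnit_sqrt ha)
  simp only [Function.comp_apply]
  rw [← mv_mul, Matrix.nonsing_inv_mul _ hu, mv_one]

end LAMN

/-! ### Convergence in law with a tight second argument -/

/-- If `X n ⇒ X`, the sequence `Y n` is tight, and almost surely `H` is continuous at `(X, y)` with
value `W` for every `y`, then `H (X n, Y n) ⇒ W`. No joint convergence of `(X n, Y n)` is needed. -/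
theorem tendstoInDistribution_of_isTightMeasureSet {E F S Ω' : Type*} {Ω : ℕ → Type*}
    [∀ n, MeasurableSpace (Ω n)] [MeasurableSpace Ω']
    [TopologicalSpace E] [MeasurableSpace E] [OpensMeasurableSpace E] [HasOuterApproxClosed E]
    [TopologicalSpace F] [T2Space F] [MeasurableSpace F] [OpensMeasurableSpace F]
    [TopologicalSpace S] [MeasurableSpace S] [OpensMeasurableSpace S]
    {μ : ∀ n, Measure (Ω n)} [∀ n, IsProbabilityMeasure (μ n)]
    {μ' : Measure Ω'} [IsProbabilityMeasure μ']
    {X : ∀ n, Ω n → E} {X' : Ω' → E} {Y : ∀ n, Ω n → F} {W : Ω' → S} {H : E × F → S}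
    (hX : TendstoInDistribution X atTop X' μ μ') (hY : ∀ n, AEMeasurable (Y n) (μ n))
    (htight : IsTightMeasureSet (Set.range fun n => (μ n).map (Y n)))
    (hH : ∀ n, AEMeasurable (fun x => H (X n x, Y n x)) (μ n)) (hW : AEMeasurable W μ')
    (hcont : ∀ᵐ x ∂μ', ∀ y, ContinuousAt H (X' x, y))
    (hval : ∀ᵐ x ∂μ', ∀ y, H (X' x, y) = W x) :
    TendstoInDistribution (fun n x => H (X n x, Y n x)) atTop W μ μ' where
  forall_aemeasurable := hH
  aemeasurable_limit := hW
  tendsto := by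
    refine tendsto_of_forall_isOpen_le_liminf' fun G hG => ?_
    change (μ'.map W) G ≤ liminf (fun n => ((μ n).map fun x => H (X n x, Y n x)) G) atTop
    refine ENNReal.le_of_forall_pos_le_add fun ε hε _ => ?_
    obtain ⟨C, hC, hCε⟩ := isTightMeasureSet_iff_exists_isCompact_measure_compl_le.1 htight ε
      (by exact_mod_cast hε)
    -- Points of `U` are those around which `H` sends all of `C` into `G`; the tube lemma shows
    -- that almost surely `W ∈ G` forces `X' ∈ U`.
    let U : Set E := interior {e | ∀ y ∈ C, H (e, y) ∈ G}
    have h1 : (μ'.map W) G ≤ (μ'.map X') U := by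
      rw [Measure.map_apply_of_aemeasurable hW hG.measurableSet,
        Measure.map_apply_of_aemeasurable hX.aemeasurable_limit isOpen_interior.measurableSet]
      refine measure_mono_ae ?_
      filter_upwards [hcont, hval] with x hc hv hx
      refine mem_interior_iff_mem_nhds.2
        (hC.eventually_forall_of_forall_eventually (P := fun e y => H (e, y) ∈ G) fun y _ => ?_)
      refine (hc y).eventually (hG.mem_nhds ?_)
      rw [hv y]
      exact hx
    have h2 : (μ'.map X') U ≤ liminf (fun n => ((μ n).map (X n)) U) atTop :=
      ProbabilityMeasure.le_liminf_measure_open_of_tendsto hX.tendsto isOpen_interior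
    have h3 (n : ℕ) : ((μ n).map (X n)) U ≤ ((μ n).map fun x => H (X n x, Y n x)) G + ε := by
      have hYC : (μ n) (Y n ⁻¹' Cᶜ) ≤ ε := by
        rw [← Measure.map_apply_of_aemeasurable (hY n) hC.measurableSet.compl]
        exact hCε _ ⟨n, rfl⟩
      rw [Measure.map_apply_of_aemeasurable (hX.forall_aemeasurable n)
          isOpen_interior.measurableSet,
        Measure.map_apply_of_aemeasurable (hH n) hG.measurableSet]
      refine (measure_mono fun x hx => ?_).trans ((measure_union_le _ _).trans (by gcongr))
      by_cases hy : Y n x ∈ C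
      · exact Or.inl (interior_subset hx _ hy)
      · exact Or.inr hy
    refine h1.trans (h2.trans ((liminf_le_liminf (Eventually.of_forall h3)).trans ?_))
    exact (liminf_add_const atTop _ _ (by isBoundedDefault) (by isBoundedDefault)).le

section Marginals

variable {E F Ω' : Type*} {Ω : ℕ → Type*} [∀ n, MeasurableSpace (Ω n)] [MeasurableSpace Ω']
  [TopologicalSpace E] [MeasurableSpace E] [TopologicalSpace F] [MeasurableSpace F] [OpensMeasurableSpace (E × F)]
  {μ : ∀ n, Measure (Ω n)} [∀ n, IsProbabilityMeasure (μ n)]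
  {μ' : Measure Ω'} [IsProbabilityMeasure μ']
  {X : ∀ n, Ω n → E} {Y : ∀ n, Ω n → F} {X' : Ω' → E} {Y' : Ω' → F}

lemma tendstoInDistribution_fst [BorelSpace E]
    (h : TendstoInDistribution (fun n x => (X n x, Y n x)) atTop (fun x => (X' x, Y' x)) μ μ') :
    TendstoInDistribution X atTop X' μ μ' :=
  h.continuous_comp continuous_fst

lemma tendstoInDistribution_snd [BorelSpace F]
    (h : TendstoInDistribution (fun n x => (X n x, Y n x)) atTop (fun x => (X' x, Y' x)) μ μ') :
    TendstoInDistribution Y atTop Y' μ μ' :=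
  h.continuous_comp continuous_snd

end Marginals

end QuadLik

theorem lemma6 {p : ℕ} {Ω : ℕ → Type*} [∀ n, MeasurableSpace (Ω n)]
    {Ω' : Type*} [MeasurableSpace Ω']
    -- the models and their log likelihoods; the true parameter value is zero
    (M : ∀ n, StatModel (Ω n) p) (qn : ∀ n, Ω n → C2 p) (hqn : ∀ n, (M n).IsLogLik (qn n))
    -- the starting points
    (δ : ∀ n, Ω n → Vec p) (hδ : ∀ n, AEMeasurable (δ n) ((M n).law 0))
    -- the limit model
    (N : StatModel Ω' p) (Z : Ω' → Vec p) (K : Ω' → Mat p) (hN : N.IsLAMN Z K)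
    (hK : ∀ᵐ x ∂(N.law 0), (K x).PosDef)
    -- convergence in law in `C²(ℝ^p)`, and tightness
    (hq : TendstoInDistribution qn atTop (fun x => C2.quad (Z x) (K x))
      (fun n => (M n).law 0) (N.law 0))
    (htight : IsTightMeasureSet (Set.range fun n => ((M n).law 0).map (δ n)))
    -- the one-step Newton estimators
    (δhat : ∀ n, Ω n → WithNaO (Vec p))
    (hδhat : ∀ n x, δhat n x = newton (qn n x) (Sum.inl (δ n x))) :
    TendstoInDistribution (fun n x => -(qn n x).hess (δ n x)) atTop K
      (fun n => (M n).law 0) (N.law 0) ∧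
    TendstoInDistribution (fun n x => obsInfo (qn n x) (δhat n x)) atTop
      (fun x => (Sum.inl (K x) : WithNaO (Mat p))) (fun n => (M n).law 0) (N.law 0) ∧
    TendstoInDistribution δhat atTop
      (fun x => (Sum.inl (mv (K x)⁻¹ (Z x)) : WithNaO (Vec p)))
      (fun n => (M n).law 0) (N.law 0) ∧
    TendstoInDistribution (fun n x => sqrtMul (obsInfo (qn n x) (δhat n x)) (δhat n x)) atTop
      (fun w : Vec p => (Sum.inl w : WithNaO (Vec p)))
      (fun n => (M n).law 0) (multivariateGaussian (0 : Vec p) (1 : Mat p)) ∧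
    -- all of these hold jointly, the last limit being the random vector `K^(-1/2) Z`
    (N.law 0).map (fun x => mv (CFC.sqrt (K x))⁻¹ (Z x)) =
      multivariateGaussian (0 : Vec p) (1 : Mat p) ∧
    TendstoInDistribution
      (fun n x => (qn n x, -(qn n x).hess (δ n x), obsInfo (qn n x) (δhat n x), δhat n x,
        sqrtMul (obsInfo (qn n x) (δhat n x)) (δhat n x)))
      atTop
      (fun x => (C2.quad (Z x) (K x), K x, (Sum.inl (K x) : WithNaO (Mat p)),
        (Sum.inl (mv (K x)⁻¹ (Z x)) : WithNaO (Vec p)),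
        (Sum.inl (mv (CFC.sqrt (K x))⁻¹ (Z x)) : WithNaO (Vec p))))
      (fun n => (M n).law 0) (N.law 0) := by
  have hZm := hN.measurable_Z
  have hKm := hN.measurable_K
  obtain rfl : δhat = fun n x => newton (qn n x) (Sum.inl (δ n x)) := funext₂ hδhat
  have hest : Measurable fun x => mv (K x)⁻¹ (Z x) := measurable_mv_inv hKm hZm
  have hstud : Measurable fun x => mv (CFC.sqrt (K x))⁻¹ (Z x) :=
    measurable_mv_inv_sqrt hKm hZm
  have hlim : AEMeasurable (fun x => (C2.quad (Z x) (K x), K x, (Sum.inl (K x) : WithNaO (Mat p)),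
      (Sum.inl (mv (K x)⁻¹ (Z x)) : WithNaO (Vec p)),
      (Sum.inl (mv (CFC.sqrt (K x))⁻¹ (Z x)) : WithNaO (Vec p)))) (N.law 0) := by
    have h3 : Measurable fun x => (Sum.inl (K x) : WithNaO (Mat p)) := measurable_inl.comp hKm
    have h4 : Measurable fun x => (Sum.inl (mv (K x)⁻¹ (Z x)) : WithNaO (Vec p)) :=
      measurable_inl.comp hest
    have h5 : Measurable fun x => (Sum.inl (mv (CFC.sqrt (K x))⁻¹ (Z x)) : WithNaO (Vec p)) :=
      measurable_inl.comp hstud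
    have h25 := hKm.prodMk (h3.prodMk (h4.prodMk h5))
    exact hq.aemeasurable_limit.prodMk h25.aemeasurable
  have hjoint : TendstoInDistribution (fun n x => newtonStats (qn n x, δ n x)) atTop
      (fun x => (C2.quad (Z x) (K x), K x, (Sum.inl (K x) : WithNaO (Mat p)),
        (Sum.inl (mv (K x)⁻¹ (Z x)) : WithNaO (Vec p)),
        (Sum.inl (mv (CFC.sqrt (K x))⁻¹ (Z x)) : WithNaO (Vec p))))
      (fun n => (M n).law 0) (N.law 0) := by
    have hm : ∀ n, AEMeasurable (fun x => newtonStats (qn n x, δ n x)) ((M n).law 0) := fun n =>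
      measurable_newtonStats.comp_aemeasurable ((hq.forall_aemeasurable n).prodMk (hδ n))
    have hc : ∀ᵐ x ∂(N.law 0), ∀ y, ContinuousAt newtonStats (C2.quad (Z x) (K x), y) := by
      filter_upwards [hK] with x hx y
      refine continuousAt_newtonStats ?_ (by rwa [newtonInfo_quad _ hx])
      rwa [C2.hess_quad _ (hN.isSymm_K x), neg_neg]
    exact tendstoInDistribution_of_isTightMeasureSet hq hδ htight hm hlim hc
      (hK.mono fun x hx y => newtonStats_quad _ hx y)
  have hgauss := hN.map_inv_sqrt_eq hK
  simp only [newtonStats] at hjoint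
  have h2 := tendstoInDistribution_snd hjoint
  have h3 := tendstoInDistribution_snd h2
  have h4 := tendstoInDistribution_snd h3
  have h5 := tendstoInDistribution_snd h4
  refine ⟨tendstoInDistribution_fst h2, tendstoInDistribution_fst h3,
    tendstoInDistribution_fst h4, ?_, hgauss, hjoint⟩
  -- The last limit `K^(-1/2) Z` may be replaced by any random vector with the same law.
  have hinl : Measurable fun w : Vec p => (Sum.inl w : WithNaO (Vec p)) := measurable_inl
  have hmap : (multivariateGaussian (0 : Vec p) (1 : Mat p)).map
      (fun w : Vec p => (Sum.inl w : WithNaO (Vec p))) =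
      (N.law 0).map fun x => (Sum.inl (mv (CFC.sqrt (K x))⁻¹ (Z x)) : WithNaO (Vec p)) := by
    rw [← hgauss, Measure.map_map hinl hstud]
    rfl
  refine ⟨h5.forall_aemeasurable, hinl.aemeasurable, ?_⟩
  convert h5.tendsto using 2
  exact congrArg _ (Subtype.ext hmap)
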